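/- Let $D$ be an integral domain with quotient field $F$. A star operation on $D$ is a map $I\mapsto I^*$ from the set of nonzero fractional ideals of $D$ to itself such that, for all nonzero fractional ideals $I,J$ and all $0\neq a\in F$: $D^*=D$, $(aI)^*=aI^*$, $I\subseteq I^*$, $I\subseteq J$ implies $I^*\subseteq J^*$, and $(I^*)^*=I^*$. It is of finite character if $I^*=\bigcup\{J^* : J\subseteq I \text{ a nonzero finitely generated } D\text{-submodule}\}$ for every nonzero fractional ideal $I$. The $t$-operation on $D$ is the star operation $I\mapsto I_t=\bigcup\{J_v : J\subseteq I \text{ a nonzero finitely generated } D\text{-submodule}\}$, where $J_v=(D:(D:J))$. A $*$-prime ideal is a nonzero prime ideal $P$ of $D$ with $P^*=P$, and $*\text{-}\mathrm{Max}(D)$ is the set of $*$-maximal ideals of $D$, i.e. of the $*$-prime ideals that are maximal under inclusion among $*$-prime ideals. Proposition 2.8. Let $R$ be an integral domain with quotient field $K$, let $X$ be an indeterminate over $R$, let $*$ be a star operation of finite character on $R[X]$, and let $\bar *$ be the star operation on $R$ induced by $*$, that is, $I^{\bar *}=(I[X])^*\cap K$ for every nonzero fractional ideal $I$ of $R$.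 The following statements are equivalent: (i) $*\text{-}\mathrm{Max}(R[X])=t\text{-}\mathrm{Max}(R[X])$; (ii) $Q_t\subsetneq R[X]$ for each $Q\in *\text{-}\mathrm{Max}(R[X])$ such that $Q\cap R\neq 0$; (iii) $\bar *\text{-}\mathrm{Max}(R)=t\text{-}\mathrm{Max}(R)$, and $Q=(Q\cap R)[X]$ for each $Q\in *\text{-}\mathrm{Max}(R[X])$ with $Q\cap R\neq 0$. -/

import Mathlib

open scoped nonZeroDivisors Polynomial

noncomputable section

/-- A star operation on the integral domain `D` with quotient field `F`: a map `I ↦ I^*` on the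
nonzero fractional ideals of `D`, extended by the usual convention `0^* = 0` so that it is defined
on Mathlib's type of all fractional ideals. -/
structure StarOperation (D F : Type*) [CommRing D] [IsDomain D] [Field F] [Algebra D F]
    [IsFractionRing D F] where
  toFun : FractionalIdeal D⁰ F → FractionalIdeal D⁰ F
  map_zero : toFun 0 = 0
  map_one : toFun 1 = 1
  map_smul : ∀ (a : F) (I : FractionalIdeal D⁰ F), a ≠ 0 →
    toFun (FractionalIdeal.spanSingleton D⁰ a * I) = FractionalIdeal.spanSingleton D⁰ a * toFun I
  le_map : ∀ I, I ≤ toFun I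
  mono : ∀ I J, I ≤ J → toFun I ≤ toFun J
  idem : ∀ I, toFun (toFun I) = toFun I

namespace StarOperation

section General

variable {D F : Type*} [CommRing D] [IsDomain D] [Field F] [Algebra D F] [IsFractionRing D F]

instance : CoeFun (StarOperation D F) fun _ => FractionalIdeal D⁰ F → FractionalIdeal D⁰ F :=
  ⟨toFun⟩

/-- `*` is of finite character: `I^*` is the union of the `J^*` over the finitely generated
`J ⊆ I`. -/
def IsFiniteCharacter (s : StarOperation D F) : Prop :=
  ∀ (I : FractionalIdeal D⁰ F) (x : F),
    x ∈ s I ↔ ∃ J : FractionalIdeal D⁰ F, (J : Submodule D F).FG ∧ J ≤ I ∧ x ∈ s J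

/-- A `*`-ideal: a nonzero (integral) ideal `I` with `I^* = I`. -/
def IsStarIdeal (s : StarOperation D F) (I : Ideal D) : Prop :=
  I ≠ ⊥ ∧ s (I : FractionalIdeal D⁰ F) = (I : FractionalIdeal D⁰ F)

/-- A `*`-prime ideal: a prime ideal that is a `*`-ideal. -/
def IsStarPrime (s : StarOperation D F) (I : Ideal D) : Prop :=
  I.IsPrime ∧ s.IsStarIdeal I

/-- `*-Max(D)`: the set of `*`-maximal ideals, i.e. of the `*`-prime ideals that are maximal with
respect to inclusion among `*`-prime ideals. -/
def starMax (s : StarOperation D F) : Set (Ideal D) :=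
  {Q | Maximal s.IsStarPrime Q}

/-- The underlying fractional ideal of `I^{*_f}`, the union of the `J^*` over the finitely generated
`J ⊆ I`. -/
def finiteFun (s : StarOperation D F) (I : FractionalIdeal D⁰ F) : FractionalIdeal D⁰ F :=
  ⟨{ carrier := {x | ∃ J : FractionalIdeal D⁰ F,
        (J : Submodule D F).FG ∧ J ≤ I ∧ x ∈ s J}
     zero_mem' := ⟨0, by simpa using Submodule.fg_bot, zero_le, (s 0).zero_mem⟩
     add_mem' := by
       rintro x y ⟨J, hJ, hJI, hx⟩ ⟨J₁, hJ₁, hJI₁, hy⟩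
       refine ⟨J ⊔ J₁, ?_, sup_le hJI hJI₁, ?_⟩
       · rw [FractionalIdeal.coe_sup]
         exact hJ.sup hJ₁
       · exact (s (J ⊔ J₁)).val.add_mem (s.mono _ _ le_sup_left hx) (s.mono _ _ le_sup_right hy)
     smul_mem' := by
       rintro c x ⟨J, hJ, hJI, hx⟩
       exact ⟨J, hJ, hJI, (s J).val.smul_mem c hx⟩ },
   FractionalIdeal.isFractional_of_le (J := s I) (by
     rintro x ⟨J, hJ, hJI, hx⟩
     exact s.mono _ _ hJI hx)⟩

theorem mem_finiteFun (s : StarOperation D F) (I : FractionalIdeal D⁰ F) (x : F) :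
    x ∈ s.finiteFun I ↔ ∃ J : FractionalIdeal D⁰ F,
      (J : Submodule D F).FG ∧ J ≤ I ∧ x ∈ s J := Iff.rfl

theorem finiteFun_le (s : StarOperation D F) (I : FractionalIdeal D⁰ F) :
    s.finiteFun I ≤ s I := by
  rintro x ⟨J, hJ, hJI, hx⟩
  exact s.mono _ _ hJI hx

theorem le_finiteFun (s : StarOperation D F) (I : FractionalIdeal D⁰ F) :
    I ≤ s.finiteFun I := by
  intro x hx
  refine ⟨FractionalIdeal.spanSingleton D⁰ x, ?_, ?_, ?_⟩
  · rw [FractionalIdeal.coe_spanSingleton]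
    exact Submodule.fg_span_singleton x
  · rwa [FractionalIdeal.spanSingleton_le_iff_mem]
  · exact s.le_map _ (FractionalIdeal.mem_spanSingleton_self _ x)

theorem finiteFun_mono (s : StarOperation D F) (I J : FractionalIdeal D⁰ F) (h : I ≤ J) :
    s.finiteFun I ≤ s.finiteFun J := by
  rintro x ⟨G, hG, hGI, hx⟩
  exact ⟨G, hG, hGI.trans h, hx⟩

theorem exists_fg_of_le_finiteFun (s : StarOperation D F) (I : FractionalIdeal D⁰ F)
    (N : Submodule D F) (hN : N.FG) (hNI : N ≤ (s.finiteFun I : Submodule D F)) :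
    ∃ J : FractionalIdeal D⁰ F, (J : Submodule D F).FG ∧ J ≤ I ∧ N ≤ (s J : Submodule D F) := by
  induction N, hN using Submodule.fg_induction with
  | singleton x =>
    obtain ⟨J, hJ, hJI, hx⟩ := hNI (Submodule.mem_span_singleton_self x)
    exact ⟨J, hJ, hJI, by simpa [Submodule.span_le] using hx⟩
  | sup N₁ N₂ h₁ h₂ ih₁ ih₂ =>
    obtain ⟨J₁, hJ₁, hI₁, hx₁⟩ := ih₁ (le_sup_left.trans hNI)
    obtain ⟨J₂, hJ₂, hI₂, hx₂⟩ := ih₂ (le_sup_right.trans hNI)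
    refine ⟨J₁ ⊔ J₂, ?_, sup_le hI₁ hI₂, sup_le ?_ ?_⟩
    · rw [FractionalIdeal.coe_sup]
      exact hJ₁.sup hJ₂
    · exact hx₁.trans (s.mono _ _ le_sup_left)
    · exact hx₂.trans (s.mono _ _ le_sup_right)

theorem finiteFun_smul_le (s : StarOperation D F) (a : F) (I : FractionalIdeal D⁰ F)
    (ha : a ≠ 0) :
    FractionalIdeal.spanSingleton D⁰ a * s.finiteFun I ≤
      s.finiteFun (FractionalIdeal.spanSingleton D⁰ a * I) := by
  intro y hy
  obtain ⟨z, ⟨J, hJ, hJI, hz⟩, rfl⟩ := FractionalIdeal.mem_singleton_mul.1 hy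
  refine ⟨FractionalIdeal.spanSingleton D⁰ a * J, ?_, mul_le_mul_right hJI _, ?_⟩
  · rw [FractionalIdeal.coe_mul, FractionalIdeal.coe_spanSingleton]
    exact (Submodule.fg_span_singleton a).mul hJ
  · rw [s.map_smul a J ha]
    exact FractionalIdeal.mem_singleton_mul.2 ⟨z, hz, rfl⟩

/-- The star operation of finite character `*_f` associated with `*`. -/
def finiteCharacter (s : StarOperation D F) : StarOperation D F where
  toFun := s.finiteFun
  map_zero := le_antisymm ((s.finiteFun_le 0).trans s.map_zero.le) zero_le
  map_one := le_antisymm ((s.finiteFun_le 1).trans s.map_one.le) (s.le_finiteFun 1)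
  map_smul := by
    intro a I ha
    refine le_antisymm ?_ (s.finiteFun_smul_le a I ha)
    have h := s.finiteFun_smul_le a⁻¹ (FractionalIdeal.spanSingleton D⁰ a * I) (inv_ne_zero ha)
    rw [← mul_assoc, FractionalIdeal.spanSingleton_mul_spanSingleton, inv_mul_cancel₀ ha,
      FractionalIdeal.spanSingleton_one, one_mul] at h
    have h₁ := mul_le_mul_right h (FractionalIdeal.spanSingleton D⁰ a)
    rwa [← mul_assoc, FractionalIdeal.spanSingleton_mul_spanSingleton, mul_inv_cancel₀ ha,
      FractionalIdeal.spanSingleton_one, one_mul] at h₁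
  le_map := s.le_finiteFun
  mono := s.finiteFun_mono
  idem := by
    intro I
    refine le_antisymm ?_ (s.le_finiteFun _)
    rintro x ⟨G, hG, hGI, hx⟩
    obtain ⟨J, hJ, hJI, hGJ⟩ := s.exists_fg_of_le_finiteFun I G hG hGI
    exact ⟨J, hJ, hJI, (s.mono _ _ hGJ).trans (s.idem J).le hx⟩

theorem one_div_ne_zero (I : FractionalIdeal D⁰ F) (hI : I ≠ 0) :
    (1 / I : FractionalIdeal D⁰ F) ≠ 0 := by
  obtain ⟨d, hd, h⟩ := I.isFractional
  have hd0 : algebraMap D F d ≠ 0 := IsFractionRing.to_map_ne_zero_of_mem_nonZeroDivisors hd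
  have hmem : algebraMap D F d ∈ (1 / I : FractionalIdeal D⁰ F) := by
    rw [FractionalIdeal.mem_div_iff_of_ne_zero hI]
    intro y hy
    obtain ⟨c, hc⟩ := h y hy
    rw [FractionalIdeal.mem_one_iff]
    exact ⟨c, by rw [hc, Algebra.smul_def]⟩
  intro h0
  rw [h0, FractionalIdeal.mem_zero_iff] at hmem
  exact hd0 hmem

theorem one_div_anti (I J : FractionalIdeal D⁰ F) (hI : I ≠ 0) (h : I ≤ J) :
    (1 / J : FractionalIdeal D⁰ F) ≤ 1 / I := by
  have hJ : J ≠ 0 := by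
    rintro rfl
    exact hI (le_antisymm h zero_le)
  intro x hx
  rw [FractionalIdeal.mem_div_iff_of_ne_zero hJ] at hx
  rw [FractionalIdeal.mem_div_iff_of_ne_zero hI]
  exact fun y hy => hx y (h hy)

theorem le_one_div_one_div (I : FractionalIdeal D⁰ F) :
    I ≤ (1 / (1 / I) : FractionalIdeal D⁰ F) := by
  rcases eq_or_ne I 0 with rfl | hI
  · exact zero_le
  · rw [FractionalIdeal.le_div_iff_mul_le (one_div_ne_zero I hI)]
    exact FractionalIdeal.mul_one_div_le_one

theorem smul_one_div (a : F) (ha : a ≠ 0) (I : FractionalIdeal D⁰ F) :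
    (1 / (FractionalIdeal.spanSingleton D⁰ a * I) : FractionalIdeal D⁰ F) =
      FractionalIdeal.spanSingleton D⁰ a⁻¹ * (1 / I) := by
  rcases eq_or_ne I 0 with rfl | hI
  · simp
  have haI : FractionalIdeal.spanSingleton D⁰ a * I ≠ 0 := by
    intro h0
    apply hI
    have h1 := congrArg (FractionalIdeal.spanSingleton D⁰ a⁻¹ * ·) h0
    simpa [← mul_assoc, FractionalIdeal.spanSingleton_mul_spanSingleton, inv_mul_cancel₀ ha] using h1
  ext x
  rw [FractionalIdeal.mem_div_iff_of_ne_zero haI, FractionalIdeal.mem_singleton_mul]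
  constructor
  · intro h
    refine ⟨a * x, ?_, by field_simp⟩
    rw [FractionalIdeal.mem_div_iff_of_ne_zero hI]
    intro y hy
    have := h (a * y) (FractionalIdeal.mem_singleton_mul.2 ⟨y, hy, rfl⟩)
    rwa [← mul_assoc, mul_comm x a] at this
  · rintro ⟨z, hz, rfl⟩ y hy
    obtain ⟨w, hw, rfl⟩ := FractionalIdeal.mem_singleton_mul.1 hy
    rw [FractionalIdeal.mem_div_iff_of_ne_zero hI] at hz
    have := hz w hw
    rwa [show a⁻¹ * z * (a * w) = z * w by field_simp]

variable (D F) in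
/-- The `v`-operation (divisorial closure) `I_v = (D : (D : I))` on `D`. In Mathlib `1 / I` is
`(D : I) = {x ∈ F | x I ⊆ D}` for `I ≠ 0`, and `1 / 0 = 0`. -/
def v : StarOperation D F where
  toFun I := 1 / (1 / I)
  map_zero := by simp
  map_one := by simp
  map_smul := by
    intro a I ha
    rw [smul_one_div a ha, smul_one_div a⁻¹ (inv_ne_zero ha), inv_inv]
  le_map := le_one_div_one_div
  mono := by
    intro I J h
    rcases eq_or_ne I 0 with rfl | hI
    · simp
    · have hJ : J ≠ 0 := by
        rintro rfl
        exact hI (le_antisymm h zero_le)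
      exact one_div_anti _ _ (one_div_ne_zero J hJ) (one_div_anti I J hI h)
  idem := by
    intro I
    rcases eq_or_ne I 0 with rfl | hI
    · simp
    · refine le_antisymm ?_ (le_one_div_one_div _)
      exact one_div_anti _ _ (one_div_ne_zero I hI) (le_one_div_one_div (1 / I))

variable (D F) in
/-- The `t`-operation `I_t = ⋃ {J_v | J ⊆ I finitely generated}` on `D`. -/
def t : StarOperation D F := (v D F).finiteCharacter

end General

section Polynomial

set_option linter.unusedSectionVars false

/- `K` is the quotient field of `R`, and `L` is the quotient field of `R[X]`, viewed as an extension
of `K` compatibly with `R ⊆ R[X]`; so `L` is `K(X)`. -/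
variable {R K L : Type*} [CommRing R] [IsDomain R]
  [Field K] [Algebra R K] [IsFractionRing R K]
  [Field L] [Algebra R[X] L] [IsFractionRing R[X] L]
  [Algebra K L] [Algebra R L] [IsScalarTower R K L] [IsScalarTower R R[X] L]

theorem aeval_map_eq (p : R[X]) :
    Polynomial.aeval (algebraMap R[X] L Polynomial.X) (p.map (algebraMap R K)) =
      algebraMap R[X] L p := by
  rw [Polynomial.aeval_map_algebraMap, Polynomial.aeval_algebraMap_apply,
    Polynomial.aeval_X_left_apply]

theorem algebraMap_C (r : R) :
    algebraMap R[X] L (Polynomial.C r) = algebraMap K L (algebraMap R K r) := by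
  rw [← IsScalarTower.algebraMap_apply R K L, IsScalarTower.algebraMap_apply R R[X] L]
  rfl

variable (L) in
/-- `I[X]` for a fractional ideal `I` of `R`: the fractional ideal of `R[X]` consisting of the
polynomials (inside `K[X] ⊆ L`) all of whose coefficients lie in `I`. -/
def polyExt (I : FractionalIdeal R⁰ K) : FractionalIdeal R[X]⁰ L :=
  ⟨{ carrier := {y | ∃ f : K[X], (∀ n, f.coeff n ∈ I) ∧
        Polynomial.aeval (algebraMap R[X] L Polynomial.X) f = y}
     zero_mem' := ⟨0, fun n => by simpa using I.zero_mem, by simp⟩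
     add_mem' := by
       rintro _ _ ⟨f, hf, rfl⟩ ⟨g, hg, rfl⟩
       exact ⟨f + g, fun n => by
         rw [Polynomial.coeff_add]
         exact I.val.add_mem (hf n) (hg n), _root_.map_add _ _ _⟩
     smul_mem' := by
       rintro p _ ⟨f, hf, rfl⟩
       refine ⟨p.map (algebraMap R K) * f, fun n => ?_, ?_⟩
       · rw [Polynomial.coeff_mul]
         refine I.val.sum_mem fun c _ => ?_
         rw [Polynomial.coeff_map, ← Algebra.smul_def]
         exact I.val.smul_mem _ (hf _)
       · rw [_root_.map_mul, aeval_map_eq, Algebra.smul_def] },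
   by
     obtain ⟨d, hd, h⟩ := I.isFractional
     refine ⟨Polynomial.C d, ?_, ?_⟩
     · rw [mem_nonZeroDivisors_iff_ne_zero] at hd ⊢
       simpa using hd
     · rintro _ ⟨f, hf, rfl⟩
       choose c hc using fun n => h _ (hf n)
       refine ⟨∑ n ∈ f.support, Polynomial.monomial n (c n), ?_⟩
       rw [← aeval_map_eq (K := K), Algebra.smul_def, algebraMap_C (K := K),
         
         ← Polynomial.aeval_C (algebraMap R[X] L Polynomial.X) (algebraMap R K d),
         ← _root_.map_mul]
       congr 1
       ext n
       have hn := hc n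
       rw [Algebra.smul_def] at hn
       rw [Polynomial.coeff_C_mul, Polynomial.coeff_map, Polynomial.finsetSum_coeff]
       simp only [Polynomial.coeff_monomial, Finset.sum_ite_eq', Polynomial.mem_support_iff]
       split_ifs with h0
       · exact hn
       · rw [_root_.map_zero, Polynomial.notMem_support_iff.1 h0, mul_zero]⟩

theorem mem_polyExt (I : FractionalIdeal R⁰ K) (y : L) :
    y ∈ polyExt L I ↔ ∃ f : K[X], (∀ n, f.coeff n ∈ I) ∧
      Polynomial.aeval (algebraMap R[X] L Polynomial.X) f = y := Iff.rfl

theorem algebraMap_mem_polyExt (I : FractionalIdeal R⁰ K) (x : K) (hx : x ∈ I) :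
    algebraMap K L x ∈ polyExt L I := by
  refine ⟨Polynomial.C x, fun n => ?_, Polynomial.aeval_C _ _⟩
  rw [Polynomial.coeff_C]
  split_ifs
  · exact hx
  · exact I.zero_mem

theorem polyExt_mono (I J : FractionalIdeal R⁰ K) (h : I ≤ J) : polyExt L I ≤ polyExt L J := by
  rintro _ ⟨f, hf, rfl⟩
  exact ⟨f, fun n => h (hf n), rfl⟩

theorem polyExt_zero : polyExt L (0 : FractionalIdeal R⁰ K) = 0 := by
  refine le_antisymm ?_ zero_le
  rintro _ ⟨f, hf, rfl⟩
  have : f = 0 := by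
    ext n
    simpa [FractionalIdeal.mem_zero_iff] using hf n
  simp [this]

theorem polyExt_one : polyExt L (1 : FractionalIdeal R⁰ K) = 1 := by
  ext y
  rw [mem_polyExt, FractionalIdeal.mem_one_iff]
  constructor
  · rintro ⟨f, hf, rfl⟩
    simp only [FractionalIdeal.mem_one_iff] at hf
    choose c hc using hf
    refine ⟨∑ n ∈ f.support, Polynomial.monomial n (c n), ?_⟩
    rw [← aeval_map_eq (K := K)]
    congr 1
    ext n
    rw [Polynomial.coeff_map, Polynomial.finsetSum_coeff]
    simp only [Polynomial.coeff_monomial, Finset.sum_ite_eq', Polynomial.mem_support_iff]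
    split_ifs with h0
    · exact hc n
    · rw [_root_.map_zero, Polynomial.notMem_support_iff.1 h0]
  · rintro ⟨p, rfl⟩
    exact ⟨p.map (algebraMap R K), fun n => by
      rw [Polynomial.coeff_map, FractionalIdeal.mem_one_iff]
      exact ⟨_, rfl⟩, aeval_map_eq p⟩

theorem polyExt_smul (a : K) (ha : a ≠ 0) (I : FractionalIdeal R⁰ K) :
    polyExt L (FractionalIdeal.spanSingleton R⁰ a * I) =
      FractionalIdeal.spanSingleton R[X]⁰ (algebraMap K L a) * polyExt L I := by
  ext y
  rw [FractionalIdeal.mem_singleton_mul]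
  constructor
  · rintro ⟨f, hf, rfl⟩
    refine ⟨Polynomial.aeval (algebraMap R[X] L Polynomial.X) (Polynomial.C a⁻¹ * f),
      ⟨_, fun n => ?_, rfl⟩, ?_⟩
    · obtain ⟨z, hz, h⟩ := FractionalIdeal.mem_singleton_mul.1 (hf n)
      rw [Polynomial.coeff_C_mul, h, inv_mul_cancel_left₀ ha]
      exact hz
    · rw [← Polynomial.aeval_C (algebraMap R[X] L Polynomial.X) a, ← _root_.map_mul, ← mul_assoc,
        ← Polynomial.C_mul, mul_inv_cancel₀ ha, Polynomial.C_1, one_mul]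
  · rintro ⟨_, ⟨f, hf, rfl⟩, rfl⟩
    refine ⟨Polynomial.C a * f, fun n => ?_, ?_⟩
    · rw [Polynomial.coeff_C_mul]
      exact FractionalIdeal.mem_singleton_mul.2 ⟨_, hf n, rfl⟩
    · rw [_root_.map_mul, Polynomial.aeval_C]

theorem mem_one_of_algebraMap_mem_one (x : K)
    (hx : algebraMap K L x ∈ (1 : FractionalIdeal R[X]⁰ L)) :
    x ∈ (1 : FractionalIdeal R⁰ K) := by
  obtain ⟨p, hp⟩ := (FractionalIdeal.mem_one_iff _).1 hx
  obtain ⟨a, b, hb, rfl⟩ := IsFractionRing.div_surjective (A := R) x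
  have hb0 : algebraMap R K b ≠ 0 := IsFractionRing.to_map_ne_zero_of_mem_nonZeroDivisors hb
  have h : algebraMap R[X] L (Polynomial.C b * p) = algebraMap R[X] L (Polynomial.C a) := by
    rw [_root_.map_mul, hp, algebraMap_C (K := K), algebraMap_C (K := K), ← _root_.map_mul,
      mul_div_cancel₀ _ hb0]
  have h1 := congrArg (Polynomial.coeff · 0) (IsFractionRing.injective R[X] L h)
  simp only [Polynomial.coeff_C_mul, Polynomial.coeff_C_zero] at h1
  rw [FractionalIdeal.mem_one_iff]
  refine ⟨p.coeff 0, ?_⟩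
  rw [← h1, _root_.map_mul, mul_div_cancel_left₀ _ hb0]

variable (K) in
/-- `J ∩ K` for a fractional ideal `J` of `R[X]`. -/
def contractK (J : FractionalIdeal R[X]⁰ L) (hJ : ∃ d ∈ R⁰, ∀ x : K, algebraMap K L x ∈ J →
    algebraMap R K d * x ∈ (1 : FractionalIdeal R⁰ K)) : FractionalIdeal R⁰ K :=
  ⟨{ carrier := {x | algebraMap K L x ∈ J}
     zero_mem' := by simpa using J.zero_mem
     add_mem' := fun {x y} hx hy => by
       change algebraMap K L (x + y) ∈ J
       rw [_root_.map_add]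
       exact J.val.add_mem hx hy
     smul_mem' := fun c x hx => by
       change algebraMap K L (c • x) ∈ J
       rw [Algebra.smul_def, _root_.map_mul, ← algebraMap_C, ← Algebra.smul_def]
       exact J.val.smul_mem _ hx },
   by
     obtain ⟨d, hd, h⟩ := hJ
     refine ⟨d, hd, fun x hx => ?_⟩
     obtain ⟨c, hc⟩ := (FractionalIdeal.mem_one_iff _).1 (h x hx)
     exact ⟨c, by rw [hc, Algebra.smul_def]⟩⟩

theorem exists_denominator (s : StarOperation R[X] L) (I : FractionalIdeal R⁰ K) :
    ∃ d ∈ R⁰, ∀ x : K, algebraMap K L x ∈ s (polyExt L I) →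
      algebraMap R K d * x ∈ (1 : FractionalIdeal R⁰ K) := by
  obtain ⟨d, hd, h⟩ := I.isFractional
  refine ⟨d, hd, fun x hx => ?_⟩
  have hd0 : algebraMap R K d ≠ 0 := IsFractionRing.to_map_ne_zero_of_mem_nonZeroDivisors hd
  have hle : FractionalIdeal.spanSingleton R⁰ (algebraMap R K d) * I ≤ 1 := by
    intro y hy
    obtain ⟨z, hz, rfl⟩ := FractionalIdeal.mem_singleton_mul.1 hy
    obtain ⟨c, hc⟩ := h z hz
    rw [FractionalIdeal.mem_one_iff]
    exact ⟨c, by rw [hc, Algebra.smul_def]⟩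
  have hle' := s.mono _ _ (polyExt_mono (L := L) _ _ hle)
  rw [polyExt_one, s.map_one, polyExt_smul _ hd0, s.map_smul _ _ (by simpa using hd0)] at hle'
  refine mem_one_of_algebraMap_mem_one (L := L) _ (hle' ?_)
  rw [_root_.map_mul]
  exact FractionalIdeal.mem_singleton_mul.2 ⟨_, hx, rfl⟩

variable (K) in
/-- The underlying map `I ↦ (I[X])^* ∩ K` of the star operation induced on `R`. -/
def inducedFun (s : StarOperation R[X] L) (I : FractionalIdeal R⁰ K) : FractionalIdeal R⁰ K :=
  contractK K (s (polyExt L I)) (exists_denominator s I)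

theorem mem_inducedFun (s : StarOperation R[X] L) (I : FractionalIdeal R⁰ K) (x : K) :
    x ∈ s.inducedFun K I ↔ algebraMap K L x ∈ s (polyExt L I) := Iff.rfl

theorem polyExt_inducedFun_le (s : StarOperation R[X] L) (I : FractionalIdeal R⁰ K) :
    polyExt L (s.inducedFun K I) ≤ s (polyExt L I) := by
  rintro _ ⟨f, hf, rfl⟩
  rw [Polynomial.aeval_eq_sum_range]
  refine (s (polyExt L I)).val.sum_mem fun n _ => ?_
  rw [Algebra.smul_def, mul_comm, ← _root_.map_pow, ← Algebra.smul_def]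
  exact (s (polyExt L I)).val.smul_mem _ (hf n)

variable (K) in
/-- The star operation `I ↦ (I[X])^* ∩ K` induced on `R` by a star operation `*` on `R[X]`. -/
def induced (s : StarOperation R[X] L) : StarOperation R K where
  toFun := s.inducedFun K
  map_zero := by
    ext x
    rw [mem_inducedFun, polyExt_zero, s.map_zero, FractionalIdeal.mem_zero_iff,
      FractionalIdeal.mem_zero_iff, map_eq_zero]
  map_one := by
    refine le_antisymm (fun x hx => ?_) (fun x hx => ?_)
    · rw [mem_inducedFun, polyExt_one, s.map_one] at hx
      exact mem_one_of_algebraMap_mem_one x hx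
    · exact s.le_map _ (algebraMap_mem_polyExt _ x hx)
  map_smul := by
    intro a I ha
    have ha' : algebraMap K L a ≠ 0 := by simpa using ha
    ext x
    rw [mem_inducedFun, polyExt_smul a ha, s.map_smul _ _ ha', FractionalIdeal.mem_singleton_mul,
      FractionalIdeal.mem_singleton_mul]
    constructor
    · rintro ⟨y, hy, h⟩
      refine ⟨a⁻¹ * x, ?_, by field_simp⟩
      rw [mem_inducedFun, _root_.map_mul, h, map_inv₀, inv_mul_cancel_left₀ ha']
      exact hy
    · rintro ⟨y, hy, rfl⟩
      exact ⟨_, hy, _root_.map_mul _ _ _⟩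
  le_map := fun I x hx => s.le_map _ (algebraMap_mem_polyExt I x hx)
  mono := fun I J h x hx => s.mono _ _ (polyExt_mono I J h) hx
  idem := by
    intro I
    refine le_antisymm (fun x hx => ?_)
      (fun x hx => s.le_map _ (algebraMap_mem_polyExt _ x hx))
    exact (s.idem (polyExt L I)).le (s.mono _ _ (s.polyExt_inducedFun_le I) hx)

end Polynomial

end StarOperation

end

/-! The `v`-operation is the largest star operation, so a star operation `*` of finite character
lies below `t`, and every `t`-prime is `*`-prime. Finite character and Zorn's lemma put every
`*`-prime inside a `*`-maximal ideal. Hence the two maximal spectra agree as soon as every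
`*`-maximal ideal is a `t`-ideal (`IsFiniteCharacter.starMax_eq_t`).

In `R[X]`, primes meeting `R` in zero are automatically `t`-ideals
(`isStarPrime_t_of_comap_C_eq_bot`), so only those with nonzero contraction matter. If such a prime
is `*`-maximal with proper `t`-closure, it is `t`-maximal; this gives the equivalence of (i) and
(ii).

Condition (iii) rests on transfer between `R` and `R[X]`. Extending a `t`-prime of `R` gives a
`t`-prime of `R[X]`, because `(I[X])_t ⊆ I_t[X]`. Conversely, a `t`-maximal ideal with nonzero
contraction is extended from a `t`-maximal ideal of `R` (`exists_eq_map_C_of_mem_starMax_t`): the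
contents of its members lie in a common `t`-maximal ideal, since a member whose content has trivial
`v`-closure, taken with a nonzero constant of the ideal, would generate an ideal with trivial
`v`-closure. -/

namespace StarOperation

/-! ### Star operations of finite character and their maximal ideals -/

section General

set_option linter.unusedSectionVars false

variable {D F : Type*} [CommRing D] [IsDomain D] [Field F] [Algebra D F] [IsFractionRing D F]

/-- If `xI ⊆ D`, applying the star operation gives `xI^* ⊆ D^* = D`, so `I^*` is multiplied into `D`
by all of `(D : I)`. -/
theorem apply_le_v (s : StarOperation D F) (I : FractionalIdeal D⁰ F) : s I ≤ v D F I := by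
  rcases eq_or_ne I 0 with rfl | hI
  · rw [s.map_zero]
    exact zero_le
  intro y hy
  refine (FractionalIdeal.mem_div_iff_of_ne_zero (one_div_ne_zero I hI)).2 fun x hx => ?_
  rcases eq_or_ne x 0 with rfl | hx0
  · rw [mul_zero]
    exact FractionalIdeal.zero_mem _
  have hle : FractionalIdeal.spanSingleton D⁰ x * I ≤ 1 := by
    intro z hz
    obtain ⟨w, hw, rfl⟩ := FractionalIdeal.mem_singleton_mul.1 hz
    exact (FractionalIdeal.mem_div_iff_of_ne_zero hI).1 hx w hw
  have h := s.mono _ _ hle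
  rw [s.map_one, s.map_smul _ _ hx0] at h
  exact h (FractionalIdeal.mem_singleton_mul.2 ⟨y, hy, mul_comm _ _⟩)

theorem mem_t (I : FractionalIdeal D⁰ F) (x : F) :
    x ∈ t D F I ↔ ∃ J : FractionalIdeal D⁰ F, (J : Submodule D F).FG ∧ J ≤ I ∧ x ∈ v D F J :=
  Iff.rfl

theorem IsFiniteCharacter.apply_le_t {s : StarOperation D F} (hs : s.IsFiniteCharacter)
    (I : FractionalIdeal D⁰ F) : s I ≤ t D F I := by
  intro x hx
  obtain ⟨J, hJ, hJI, hxJ⟩ := (hs I x).1 hx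
  exact (mem_t I x).2 ⟨J, hJ, hJI, s.apply_le_v J hxJ⟩

variable (D F) in
theorem isFiniteCharacter_t : (t D F).IsFiniteCharacter := by
  intro I x
  constructor
  · rintro ⟨J, hJ, hJI, hx⟩
    exact ⟨J, hJ, hJI, J, hJ, le_rfl, hx⟩
  · rintro ⟨J, _, hJI, hx⟩
    exact (t D F).mono _ _ hJI hx

theorem apply_coeIdeal_le_one (s : StarOperation D F) (I : Ideal D) :
    s (I : FractionalIdeal D⁰ F) ≤ 1 :=
  (s.mono _ _ FractionalIdeal.coeIdeal_le_one).trans s.map_one.le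

theorem eq_one_of_one_mem {I : FractionalIdeal D⁰ F} (hI : I ≤ 1) (h : (1 : F) ∈ I) : I = 1 :=
  le_antisymm hI (FractionalIdeal.one_le.2 h)

theorem one_mem_coeIdeal {I : Ideal D} :
    (1 : F) ∈ (I : FractionalIdeal D⁰ F) ↔ I = ⊤ := by
  rw [Ideal.eq_top_iff_one, FractionalIdeal.mem_coeIdeal]
  constructor
  · rintro ⟨x, hx, h⟩
    rwa [← IsFractionRing.injective D F (h.trans (_root_.map_one (algebraMap D F)).symm)]
  · exact fun h => ⟨1, h, _root_.map_one _⟩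

theorem fg_of_coeIdeal_fg {J : Ideal D}
    (hJ : ((J : FractionalIdeal D⁰ F) : Submodule D F).FG) : J.FG :=
  (FractionalIdeal.coeIdeal_fg _ (IsFractionRing.injective D F) J).1 hJ

theorem exists_le_of_fg_le_sSup {J : Ideal D} (hJ : J.FG) {c : Set (Ideal D)} (hc : c.Nonempty)
    (hdir : DirectedOn (· ≤ ·) c) (h : J ≤ sSup c) : ∃ I ∈ c, J ≤ I :=
  (CompleteLattice.isCompactElement_iff_le_of_directed_sSup_le _ J).1
    ((Submodule.fg_iff_compact J).1 hJ) c hc hdir h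

theorem IsStarIdeal.of_le {s s' : StarOperation D F} (h : ∀ I, s I ≤ s' I) {I : Ideal D}
    (hI : s'.IsStarIdeal I) : s.IsStarIdeal I :=
  ⟨hI.1, le_antisymm ((h _).trans hI.2.le) (s.le_map _)⟩

theorem IsStarPrime.one_notMem {s : StarOperation D F} {I : Ideal D} (hI : s.IsStarPrime I) :
    (1 : F) ∉ s (I : FractionalIdeal D⁰ F) := by
  rw [hI.2.2, one_mem_coeIdeal]
  exact hI.1.ne_top

/-- By idempotence `M^*` also satisfies the defining condition, so maximality forces `M^* = M`. If
`ab ∈ M` and `a ∉ M`, then `1 ∈ (M + aD)^*`; multiplying by `b` gives `b ∈ (b(M + aD))^* ⊆ M^* = M`.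
-/
theorem isStarPrime_of_maximal {s : StarOperation D F} {M : Ideal D} (hM0 : M ≠ ⊥)
    (hM : Maximal (fun I : Ideal D => (1 : F) ∉ s (I : FractionalIdeal D⁰ F)) M) :
    s.IsStarPrime M := by
  have hstar : s (M : FractionalIdeal D⁰ F) = (M : FractionalIdeal D⁰ F) := by
    obtain ⟨B, hB⟩ := FractionalIdeal.le_one_iff_exists_coeIdeal.1 (s.apply_coeIdeal_le_one M)
    have hMB : M ≤ B := by
      rw [← FractionalIdeal.coeIdeal_le_coeIdeal F, hB]
      exact s.le_map _
    have hB1 : (1 : F) ∉ s (B : FractionalIdeal D⁰ F) := by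
      rw [hB, s.idem]
      exact hM.1
    rw [← hB, le_antisymm (hM.2 hB1 hMB) hMB]
  refine ⟨⟨fun h => hM.1 ?_, ?_⟩, hM0, hstar⟩
  · rw [hstar, one_mem_coeIdeal]
    exact h
  intro a b hab
  by_contra! hcon
  obtain ⟨ha, hb⟩ := hcon
  have hb0 : algebraMap D F b ≠ 0 := by
    intro h
    rw [← _root_.map_zero (algebraMap D F)] at h
    exact hb (IsFractionRing.injective D F h ▸ M.zero_mem)
  have h1 : (1 : F) ∈ s ((M ⊔ Ideal.span {a} : Ideal D) : FractionalIdeal D⁰ F) := by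
    by_contra h
    exact ha (hM.2 h le_sup_left (Ideal.mem_sup_right (Ideal.mem_span_singleton_self a)))
  have hle : Ideal.span {b} * (M ⊔ Ideal.span {a}) ≤ M := by
    rw [Ideal.mul_sup, Ideal.span_singleton_mul_span_singleton, mul_comm b a]
    exact sup_le Ideal.mul_le_right ((Ideal.span_singleton_le_iff_mem M).2 hab)
  have h := s.mono _ _ ((FractionalIdeal.coeIdeal_le_coeIdeal F).2 hle)
  rw [FractionalIdeal.coeIdeal_mul, FractionalIdeal.coeIdeal_span_singleton, s.map_smul _ _ hb0,
    hstar] at h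
  obtain ⟨c, hc, hcb⟩ := (FractionalIdeal.mem_coeIdeal _).1
    (h (FractionalIdeal.mem_singleton_mul.2 ⟨1, h1, (mul_one _).symm⟩))
  exact hb (IsFractionRing.injective D F hcb ▸ hc)

/-- For a star operation of finite character, an ideal whose closure is proper lies in a
`*`-maximal ideal. -/
theorem IsFiniteCharacter.exists_le_starMax {s : StarOperation D F} (hs : s.IsFiniteCharacter)
    {A : Ideal D} (hA0 : A ≠ ⊥) (hA : (1 : F) ∉ s (A : FractionalIdeal D⁰ F)) :
    ∃ M ∈ s.starMax, A ≤ M := by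
  obtain ⟨M, hAM, hM⟩ := zorn_le_nonempty₀
    {I : Ideal D | (1 : F) ∉ s (I : FractionalIdeal D⁰ F)} (fun c hc hchain y hy => by
      refine ⟨sSup c, fun h1 => ?_, fun z hz => le_sSup hz⟩
      -- Finite character makes the condition inductive: if the closure of the union contains `1`,
      -- so does that of a finitely generated subideal, which already lies in one member of the
      -- chain.
      obtain ⟨J, hJ, hJI, h1J⟩ := (hs _ _).1 h1
      obtain ⟨J, rfl⟩ :=
        FractionalIdeal.le_one_iff_exists_coeIdeal.1 (hJI.trans FractionalIdeal.coeIdeal_le_one)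
      obtain ⟨I, hI, hJI⟩ := exists_le_of_fg_le_sSup (fg_of_coeIdeal_fg hJ) ⟨y, hy⟩
        hchain.directedOn ((FractionalIdeal.coeIdeal_le_coeIdeal F).1 hJI)
      exact hc hI (s.mono _ _ ((FractionalIdeal.coeIdeal_le_coeIdeal F).2 hJI) h1J)) A hA
  refine ⟨M, ⟨isStarPrime_of_maximal (ne_bot_of_le_ne_bot hA0 hAM) hM, fun P hP hMP => ?_⟩, hAM⟩
  exact hM.2 hP.one_notMem hMP

theorem IsFiniteCharacter.exists_starPrime_le_starMax {s : StarOperation D F}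
    (hs : s.IsFiniteCharacter) {P : Ideal D} (hP : s.IsStarPrime P) : ∃ M ∈ s.starMax, P ≤ M :=
  hs.exists_le_starMax hP.2.1 hP.one_notMem

theorem IsFiniteCharacter.isStarPrime_of_t {s : StarOperation D F} (hs : s.IsFiniteCharacter)
    {P : Ideal D} (hP : (t D F).IsStarPrime P) : s.IsStarPrime P :=
  ⟨hP.1, hP.2.of_le hs.apply_le_t⟩

/-- The `t`-primes are always among the `*`-primes, and every `*`-prime lies below a `*`-maximal
ideal, so `*`-maximal ideals that are `t`-primes are exactly the maximal `t`-primes. -/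
theorem IsFiniteCharacter.starMax_eq_t {s : StarOperation D F} (hs : s.IsFiniteCharacter)
    (h : ∀ Q ∈ s.starMax, (t D F).IsStarPrime Q) : s.starMax = (t D F).starMax := by
  ext Q
  constructor
  · exact fun hQ => ⟨h Q hQ, fun P hP hQP => hQ.2 (hs.isStarPrime_of_t hP) hQP⟩
  · intro hQ
    obtain ⟨M, hM, hQM⟩ := hs.exists_starPrime_le_starMax (hs.isStarPrime_of_t hQ.1)
    rwa [le_antisymm hQM (hQ.2 (h M hM) hQM)]

/-- A `*`-maximal ideal whose `t`-closure is proper is `t`-maximal. -/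
theorem IsFiniteCharacter.mem_starMax_t_of_lt_one {s : StarOperation D F}
    (hs : s.IsFiniteCharacter) {Q : Ideal D} (hQ : Q ∈ s.starMax)
    (h : t D F (Q : FractionalIdeal D⁰ F) < 1) : Q ∈ (t D F).starMax := by
  obtain ⟨M, hM, hQM⟩ := (isFiniteCharacter_t D F).exists_le_starMax hQ.1.2.1
    fun h1 => h.ne (eq_one_of_one_mem h.le h1)
  rwa [le_antisymm hQM (hQ.2 (hs.isStarPrime_of_t hM.1) hQM)]

end General

end StarOperation

/-! ### Polynomial lemmas: McCoy's argument, pseudo-division, content -/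

/-- McCoy's argument: if no element outside the image of `φ` is multiplied into it by all
coefficients of `f`, then a polynomial `g` with `f g` over the image of `φ` is itself over it. -/
theorem Polynomial.mem_lifts_of_map_mul_mem_lifts {R K : Type*} [CommRing R] [CommRing K]
    (φ : R →+* K) (f : R[X]) (hf : ∀ x, (∀ n, φ (f.coeff n) * x ∈ φ.range) → x ∈ φ.range)
    (g : K[X]) (hfg : f.map φ * g ∈ Polynomial.liftsRing φ) : g ∈ Polynomial.liftsRing φ := by
  have coeff_mem : ∀ p : K[X], p ∈ Polynomial.liftsRing φ ↔ ∀ n, p.coeff n ∈ φ.range := fun p =>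
    Polynomial.lifts_iff_coeff_lifts p
  have hmap : ∀ p : R[X], p.map φ ∈ Polynomial.liftsRing φ := fun p =>
    (coeff_mem _).2 fun n => ⟨p.coeff n, (Polynomial.coeff_map φ n).symm⟩
  -- Induction on a strict bound `d` for the degree of `g`, which also covers `g = 0`.
  suffices H : ∀ (d : ℕ) (g : K[X]), (∀ n, d ≤ n → g.coeff n = 0) →
      f.map φ * g ∈ Polynomial.liftsRing φ → g ∈ Polynomial.liftsRing φ from
    H (g.natDegree + 1) g (fun n hn => Polynomial.coeff_eq_zero_of_natDegree_lt hn) hfg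
  intro d
  induction d with
  | zero =>
    intro g hg _
    rw [show g = 0 from Polynomial.ext fun n => hg n (Nat.zero_le n)]
    exact Subring.zero_mem _
  | succ d ih =>
    intro g hg hfg
    have key : ∀ i, (∀ j, i < j → Polynomial.C (φ (f.coeff j)) * g ∈ Polynomial.liftsRing φ) →
        Polynomial.C (φ (f.coeff i)) * g ∈ Polynomial.liftsRing φ := by
      intro i hi
      -- In the coefficient of index `i + d` of `f g`, terms with a lower index in `f` vanish and
      -- those with a higher one are lifted by `hi`. Once this top coefficient is known to lift,
      -- removing it from `f_i g` leaves a polynomial with bound `d`, to which `ih` applies.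
      have hid : φ (f.coeff i) * g.coeff d ∈ φ.range := by
        have hsum := (coeff_mem _).1 hfg (i + d)
        rw [Polynomial.coeff_mul, ← Finset.add_sum_erase _ _
          (Finset.HasAntidiagonal.mem_antidiagonal.2 (rfl : (i, d).1 + (i, d).2 = i + d))] at hsum
        rw [← Polynomial.coeff_map]
        refine (add_mem_cancel_right (Subring.sum_mem _ fun c hc => ?_)).1 hsum
        obtain ⟨hne, hc⟩ := Finset.mem_erase.1 hc
        rw [Finset.HasAntidiagonal.mem_antidiagonal] at hc
        rcases lt_trichotomy c.1 i with h | h | h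
        · rw [hg c.2 (by omega), mul_zero]
          exact Subring.zero_mem _
        · exact absurd (Prod.ext h (by simp only; omega)) hne
        · rw [Polynomial.coeff_map, ← Polynomial.coeff_C_mul]
          exact (coeff_mem _).1 (hi c.1 h) c.2
      have hmon : Polynomial.monomial d (φ (f.coeff i) * g.coeff d) ∈ Polynomial.liftsRing φ := by
        obtain ⟨r, hr⟩ := hid
        rw [← hr, ← Polynomial.map_monomial]
        exact hmap _
      have hC : Polynomial.C (φ (f.coeff i)) ∈ Polynomial.liftsRing φ := by
        rw [← Polynomial.map_C]
        exact hmap _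
      rw [← sub_add_cancel (Polynomial.C (φ (f.coeff i)) * g)
        (Polynomial.monomial d (φ (f.coeff i) * g.coeff d))]
      refine Subring.add_mem _ (ih _ (fun n hn => ?_) ?_) hmon
      · rw [Polynomial.coeff_sub, Polynomial.coeff_C_mul, Polynomial.coeff_monomial]
        split_ifs with h
        · rw [h, sub_self]
        · rw [hg n (by omega), mul_zero, sub_zero]
      · rw [mul_sub, mul_left_comm]
        exact Subring.sub_mem _ (Subring.mul_mem _ hC hfg) (Subring.mul_mem _ (hmap f) hmon)
    -- Descending induction on `i`, starting above the degree of `f`, where the coefficients are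
    -- zero.
    have hall : ∀ k i, f.natDegree < i + k →
        Polynomial.C (φ (f.coeff i)) * g ∈ Polynomial.liftsRing φ := by
      intro k
      induction k with
      | zero =>
        intro i hi
        rw [Polynomial.coeff_eq_zero_of_natDegree_lt (by omega : f.natDegree < i), map_zero,
          map_zero, zero_mul]
        exact Subring.zero_mem _
      | succ k ihk => exact fun i hi => key i fun j hj => ihk j (by omega)
    refine (coeff_mem g).2 fun n => hf _ fun i => ?_
    rw [← Polynomial.coeff_C_mul]
    exact (coeff_mem _).1 (hall (f.natDegree + 1) i (by omega)) n

/-- A nonzero ideal of `R[X]` is, up to constants, generated by one of its elements. -/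
theorem Ideal.exists_dvd_C_mul_of_ne_bot {R : Type*} [CommRing R] [IsDomain R]
    {Q : Ideal R[X]} (hQ : Q ≠ ⊥) :
    ∃ h ∈ Q, h ≠ 0 ∧ ∀ f ∈ Q, ∃ c : R, c ≠ 0 ∧ h ∣ Polynomial.C c * f := by
  classical
  obtain ⟨h₀, hh₀, hh₀0⟩ := Submodule.exists_mem_ne_zero_of_ne_bot hQ
  have hex : ∃ n, ∃ h ∈ Q, h ≠ 0 ∧ h.natDegree = n := ⟨_, h₀, hh₀, hh₀0, rfl⟩
  obtain ⟨h, hhQ, hh0, hdeg⟩ := Nat.find_spec hex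
  have hmin : ∀ f ∈ Q, f ≠ 0 → h.natDegree ≤ f.natDegree := fun f hf hf0 =>
    hdeg.trans_le (Nat.find_min' hex ⟨f, hf, hf0, rfl⟩)
  have hlc : h.leadingCoeff ≠ 0 := Polynomial.leadingCoeff_ne_zero.2 hh0
  refine ⟨h, hhQ, hh0, fun f hf => ?_⟩
  induction hn : f.natDegree using Nat.strong_induction_on generalizing f with
  | _ n ih =>
    rcases eq_or_ne f 0 with rfl | hf0
    · exact ⟨1, one_ne_zero, by simp⟩
    have hflc : f.leadingCoeff ≠ 0 := Polynomial.leadingCoeff_ne_zero.2 hf0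
    -- One step of pseudo-division by `h`, a nonzero element of least degree in `Q`: `m * h` cancels
    -- the leading term of `f` scaled by the leading coefficient of `h`.
    set m := Polynomial.C f.leadingCoeff * Polynomial.X ^ (f.natDegree - h.natDegree) with hm
    have hp0 : Polynomial.C h.leadingCoeff * f ≠ 0 :=
      mul_ne_zero (Polynomial.C_ne_zero.2 hlc) hf0
    have hlt : (Polynomial.C h.leadingCoeff * f - m * h).degree < f.degree := by
      have := Polynomial.degree_sub_lt_left (p := Polynomial.C h.leadingCoeff * f) (q := m * h) (by
        rw [Polynomial.degree_C_mul hlc, hm, Polynomial.degree_mul,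
          Polynomial.degree_C_mul_X_pow _ hflc,
          Polynomial.degree_eq_natDegree hf0, Polynomial.degree_eq_natDegree hh0, ← Nat.cast_add,
          Nat.sub_add_cancel (hmin f hf hf0)]) hp0 (by
        rw [hm, Polynomial.leadingCoeff_mul, Polynomial.leadingCoeff_mul,
          Polynomial.leadingCoeff_C_mul_X_pow, Polynomial.leadingCoeff_C, mul_comm])
      rwa [Polynomial.degree_C_mul hlc] at this
    rcases eq_or_ne (Polynomial.C h.leadingCoeff * f - m * h) 0 with h0 | h0
    · exact ⟨_, hlc, sub_eq_zero.1 h0 ▸ dvd_mul_left h m⟩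
    · obtain ⟨c, hc, hdvd⟩ := ih _ (hn ▸ Polynomial.natDegree_lt_natDegree h0 hlt) _
        (Q.sub_mem (Q.mul_mem_left _ hf) (Q.mul_mem_left _ hhQ)) rfl
      refine ⟨c * h.leadingCoeff, mul_ne_zero hc hlc, ?_⟩
      rw [mul_sub, ← mul_assoc, ← mul_assoc, ← Polynomial.C_mul] at hdvd
      exact (dvd_sub_left (dvd_mul_left h _)).1 hdvd

theorem Polynomial.contentIdeal_le_iff {R : Type*} [CommRing R] {f : R[X]} {I : Ideal R} :
    f.contentIdeal ≤ I ↔ ∀ n, f.coeff n ∈ I := by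
  refine ⟨fun h n => h (f.coeff_mem_contentIdeal n), fun h => Ideal.span_le.2 fun x hx => ?_⟩
  obtain ⟨n, -, rfl⟩ := Polynomial.mem_coeffs_iff.1 hx
  exact h n

/-! ### Extension of ideals to `R[X]` and its compatibility with `v` and `t` -/

namespace StarOperation

section Polynomial

set_option linter.unusedSectionVars false

variable {R K L : Type*} [CommRing R] [IsDomain R]
  [Field K] [Algebra R K] [IsFractionRing R K]
  [Field L] [Algebra R[X] L] [IsFractionRing R[X] L]
  [Algebra K L] [Algebra R L] [IsScalarTower R K L] [IsScalarTower R R[X] L]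

variable (R K L) in
theorem aeval_algebraMap_X_injective :
    Function.Injective (Polynomial.aeval (R := K) (algebraMap R[X] L Polynomial.X)) := by
  rw [injective_iff_map_eq_zero]
  intro f hf
  obtain ⟨b, hb, h⟩ := IsLocalization.integerNormalization_spec R⁰ f
  have hb0 : algebraMap R K b ≠ 0 := IsFractionRing.to_map_ne_zero_of_mem_nonZeroDivisors hb
  have hp : algebraMap R[X] L (IsLocalization.integerNormalization R⁰ f) = 0 := by
    rw [← aeval_map_eq (K := K), h, ← IsScalarTower.algebraMap_smul K b f, _root_.map_smul, hf,
      smul_zero]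
  rw [(map_eq_zero_iff _ (IsFractionRing.injective R[X] L)).1 hp, Polynomial.map_zero,
    ← IsScalarTower.algebraMap_smul K b f] at h
  exact (smul_eq_zero.1 h.symm).resolve_left hb0

theorem aeval_mem_polyExt (I : FractionalIdeal R⁰ K) (f : K[X]) :
    Polynomial.aeval (algebraMap R[X] L Polynomial.X) f ∈ polyExt L I ↔ ∀ n, f.coeff n ∈ I := by
  constructor
  · rintro ⟨g, hg, h⟩
    rwa [← aeval_algebraMap_X_injective R K L h]
  · exact fun h => ⟨f, h, rfl⟩

/-- An element of `L` multiplied into `R[X]` by a nonzero element of `K` is a polynomial. -/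
theorem exists_aeval_eq_of_mul_mem_one {x : K} (hx : x ≠ 0) {y : L}
    (hy : y * algebraMap K L x ∈ (1 : FractionalIdeal R[X]⁰ L)) :
    ∃ f : K[X], Polynomial.aeval (algebraMap R[X] L Polynomial.X) f = y := by
  obtain ⟨p, hp⟩ := (FractionalIdeal.mem_one_iff _).1 hy
  refine ⟨Polynomial.C x⁻¹ * p.map (algebraMap R K), ?_⟩
  rw [_root_.map_mul, aeval_map_eq, hp, Polynomial.aeval_C, mul_comm, mul_assoc, ← _root_.map_mul,
    mul_inv_cancel₀ hx, _root_.map_one, mul_one]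

variable (K) in
theorem polyExt_coeIdeal (P : Ideal R) :
    polyExt L (P : FractionalIdeal R⁰ K) =
      ((P.map Polynomial.C : Ideal R[X]) : FractionalIdeal R[X]⁰ L) := by
  ext y
  rw [FractionalIdeal.mem_coeIdeal]
  constructor
  · intro hy
    have hy1 := polyExt_mono (L := L) _ _ (FractionalIdeal.coeIdeal_le_one (I := P)) hy
    rw [polyExt_one] at hy1
    obtain ⟨p, rfl⟩ := (FractionalIdeal.mem_one_iff _).1 hy1
    refine ⟨p, Ideal.mem_map_C_iff.2 fun n => ?_, rfl⟩
    rw [← aeval_map_eq (K := K), aeval_mem_polyExt] at hy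
    obtain ⟨r, hr, h⟩ := (FractionalIdeal.mem_coeIdeal _).1 (hy n)
    rw [Polynomial.coeff_map] at h
    rwa [← IsFractionRing.injective R K h]
  · rintro ⟨p, hp, rfl⟩
    rw [← aeval_map_eq (K := K), aeval_mem_polyExt]
    intro n
    rw [Polynomial.coeff_map]
    exact (FractionalIdeal.mem_coeIdeal _).2 ⟨_, Ideal.mem_map_C_iff.1 hp n, rfl⟩

theorem exists_fg_le_of_finset (I : FractionalIdeal R⁰ K) (S : Finset K) (hS : ∀ x ∈ S, x ∈ I) :
    ∃ J : FractionalIdeal R⁰ K, (J : Submodule R K).FG ∧ J ≤ I ∧ ∀ x ∈ S, x ∈ J := by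
  have hle : Submodule.span R (S : Set K) ≤ (I : Submodule R K) := Submodule.span_le.2 hS
  exact ⟨⟨Submodule.span R S, FractionalIdeal.isFractional_of_le (J := I) hle⟩, ⟨S, rfl⟩, hle,
    fun x hx => Submodule.subset_span hx⟩

/-- Finitely many generators have finitely many coefficients in all; these generate `J`. -/
theorem exists_fg_le_polyExt (I : FractionalIdeal R⁰ K) (N : Submodule R[X] L) (hN : N.FG)
    (hNI : N ≤ (polyExt L I : Submodule R[X] L)) :
    ∃ J : FractionalIdeal R⁰ K, (J : Submodule R K).FG ∧ J ≤ I ∧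
      N ≤ (polyExt L J : Submodule R[X] L) := by
  classical
  induction N, hN using Submodule.fg_induction with
  | singleton x =>
    obtain ⟨f, hf, rfl⟩ := hNI (Submodule.mem_span_singleton_self x)
    obtain ⟨J, hJ, hJI, h⟩ := exists_fg_le_of_finset I (f.support.image f.coeff) (by
      intro x hx
      obtain ⟨n, -, rfl⟩ := Finset.mem_image.1 hx
      exact hf n)
    refine ⟨J, hJ, hJI, (Submodule.span_singleton_le_iff_mem _ _).2 ⟨f, fun n => ?_, rfl⟩⟩
    by_cases hn : n ∈ f.support
    · exact h _ (Finset.mem_image_of_mem _ hn)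
    · rw [Polynomial.notMem_support_iff.1 hn]
      exact J.zero_mem
  | sup N₁ N₂ h₁ h₂ ih₁ ih₂ =>
    obtain ⟨J₁, hJ₁, hI₁, hx₁⟩ := ih₁ (le_sup_left.trans hNI)
    obtain ⟨J₂, hJ₂, hI₂, hx₂⟩ := ih₂ (le_sup_right.trans hNI)
    refine ⟨J₁ ⊔ J₂, ?_, sup_le hI₁ hI₂, sup_le ?_ ?_⟩
    · rw [FractionalIdeal.coe_sup]
      exact hJ₁.sup hJ₂
    · exact hx₁.trans (polyExt_mono _ _ le_sup_left)
    · exact hx₂.trans (polyExt_mono _ _ le_sup_right)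

theorem IsFiniteCharacter.induced {s : StarOperation R[X] L} (hs : s.IsFiniteCharacter) :
    (s.induced K).IsFiniteCharacter := by
  intro I x
  constructor
  · intro hx
    obtain ⟨N, hN, hNI, hxN⟩ := (hs _ _).1 hx
    obtain ⟨J, hJ, hJI, hNJ⟩ := exists_fg_le_polyExt I (N : Submodule R[X] L) hN
      (FractionalIdeal.coe_le_coe.2 hNI)
    exact ⟨J, hJ, hJI, s.mono _ _ hNJ hxN⟩
  · rintro ⟨J, _, hJI, hx⟩
    exact (s.induced K).mono _ _ hJI hx

/-- Each `x ∈ (R : I)` multiplies `I[X]` into `R[X]`, hence also its `v`-closure. A single nonzero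
`x` shows that elements of the closure are polynomials over `K`; comparing coefficients for all `x`
puts their coefficients in `I_v`. -/
theorem v_polyExt_le (I : FractionalIdeal R⁰ K) :
    v R[X] L (polyExt L I) ≤ polyExt L (v R K I) := by
  rcases eq_or_ne I 0 with rfl | hI
  · rw [polyExt_zero, (v R[X] L).map_zero]
    exact zero_le
  have hI' : polyExt L I ≠ 0 := by
    obtain ⟨x, hx, hx0⟩ := Submodule.exists_mem_ne_zero_of_ne_bot
      (FractionalIdeal.coeToSubmodule_eq_bot.not.2 hI)
    intro h
    have := algebraMap_mem_polyExt (L := L) I x hx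
    rw [h, FractionalIdeal.mem_zero_iff, map_eq_zero] at this
    exact hx0 this
  intro y hy
  have hmul : ∀ x ∈ (1 / I : FractionalIdeal R⁰ K),
      y * algebraMap K L x ∈ (1 : FractionalIdeal R[X]⁰ L) := by
    intro x hx
    refine (FractionalIdeal.mem_div_iff_of_ne_zero (one_div_ne_zero _ hI')).1 hy _ ?_
    rw [FractionalIdeal.mem_div_iff_of_ne_zero hI']
    rintro _ ⟨f, hf, rfl⟩
    rw [← polyExt_one (K := K), ← Polynomial.aeval_C (algebraMap R[X] L Polynomial.X) x,
      ← _root_.map_mul, aeval_mem_polyExt]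
    intro n
    rw [Polynomial.coeff_C_mul]
    exact (FractionalIdeal.mem_div_iff_of_ne_zero hI).1 hx _ (hf n)
  obtain ⟨x₀, hx₀, hx₀0⟩ := Submodule.exists_mem_ne_zero_of_ne_bot
    (FractionalIdeal.coeToSubmodule_eq_bot.not.2 (one_div_ne_zero I hI))
  obtain ⟨f, rfl⟩ := exists_aeval_eq_of_mul_mem_one hx₀0 (hmul x₀ hx₀)
  rw [aeval_mem_polyExt]
  intro n
  refine (FractionalIdeal.mem_div_iff_of_ne_zero (one_div_ne_zero I hI)).2 fun x hx => ?_
  have h := hmul x hx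
  rw [← polyExt_one (K := K), ← Polynomial.aeval_C (algebraMap R[X] L Polynomial.X) x,
    ← _root_.map_mul, aeval_mem_polyExt] at h
  rw [← Polynomial.coeff_mul_C]
  exact h n

theorem t_polyExt_le (I : FractionalIdeal R⁰ K) :
    t R[X] L (polyExt L I) ≤ polyExt L (t R K I) := by
  rintro y ⟨N, hN, hNI, hy⟩
  obtain ⟨J, hJ, hJI, hNJ⟩ := exists_fg_le_polyExt I (N : Submodule R[X] L) hN
      (FractionalIdeal.coe_le_coe.2 hNI)
  refine polyExt_mono _ _ ?_ (v_polyExt_le J ((v R[X] L).mono _ _ hNJ hy))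
  exact fun x hx => ⟨J, hJ, hJI, hx⟩

theorem comap_C_map_C (P : Ideal R) : (P.map Polynomial.C).comap Polynomial.C = P := by
  ext r
  rw [Ideal.mem_comap, Ideal.mem_map_C_iff]
  refine ⟨fun h => by simpa using h 0, fun h n => ?_⟩
  rw [Polynomial.coeff_C]
  split_ifs
  · exact h
  · exact P.zero_mem

theorem map_C_ne_bot {P : Ideal R} (hP : P ≠ ⊥) : P.map Polynomial.C ≠ ⊥ :=
  (Ideal.map_eq_bot_iff_of_injective Polynomial.C_injective).not.2 hP

variable (K) in
theorem isStarPrime_t_map_C {P : Ideal R} (hP : (t R K).IsStarPrime P) :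
    (t R[X] L).IsStarPrime (P.map Polynomial.C) := by
  have := hP.1
  refine ⟨Ideal.isPrime_map_C_of_isPrime, map_C_ne_bot hP.2.1,
    le_antisymm ?_ ((t R[X] L).le_map _)⟩
  rw [← polyExt_coeIdeal K]
  refine (t_polyExt_le _).trans ?_
  rw [hP.2.2]

variable (K) in
theorem IsStarIdeal.induced_of_map_C {s : StarOperation R[X] L} {P : Ideal R} (hP : P ≠ ⊥)
    (h : s.IsStarIdeal (P.map Polynomial.C)) : (s.induced K).IsStarIdeal P := by
  refine ⟨hP, le_antisymm (fun x hx => ?_) ((s.induced K).le_map _)⟩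
  change algebraMap K L x ∈ s (polyExt L (P : FractionalIdeal R⁰ K)) at hx
  rw [polyExt_coeIdeal, h.2, ← polyExt_coeIdeal K,
    ← Polynomial.aeval_C (algebraMap R[X] L Polynomial.X) x, aeval_mem_polyExt] at hx
  simpa using hx 0

/-- Uppers to zero are `t`-ideals: a nonzero prime of `R[X]` meeting `R` in zero is a
`t`-ideal. -/
theorem isStarPrime_t_of_comap_C_eq_bot {Q : Ideal R[X]} (hQ : Q.IsPrime) (hQ0 : Q ≠ ⊥)
    (hQR : Q.comap Polynomial.C = ⊥) : (t R[X] L).IsStarPrime Q := by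
  refine ⟨hQ, hQ0, le_antisymm ?_ ((t R[X] L).le_map _)⟩
  obtain ⟨h, hhQ, hh0, hdvd⟩ := Ideal.exists_dvd_C_mul_of_ne_bot hQ0
  have hfg : ∀ N : Ideal R[X], N.FG → N ≤ Q →
      ∃ c : R, c ≠ 0 ∧ ∀ f ∈ N, h ∣ Polynomial.C c * f := by
    intro N hN hNQ
    induction N, hN using Submodule.fg_induction with
    | singleton f =>
      obtain ⟨c, hc, hcf⟩ := hdvd f (hNQ (Submodule.mem_span_singleton_self f))
      refine ⟨c, hc, fun g hg => ?_⟩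
      obtain ⟨p, rfl⟩ := Submodule.mem_span_singleton.1 hg
      rw [smul_eq_mul, mul_left_comm]
      exact hcf.mul_left p
    | sup N₁ N₂ h₁ h₂ ih₁ ih₂ =>
      obtain ⟨c₁, hc₁, hN₁⟩ := ih₁ (le_sup_left.trans hNQ)
      obtain ⟨c₂, hc₂, hN₂⟩ := ih₂ (le_sup_right.trans hNQ)
      refine ⟨c₁ * c₂, mul_ne_zero hc₁ hc₂, fun f hf => ?_⟩
      obtain ⟨f₁, hf₁, f₂, hf₂, rfl⟩ := Submodule.mem_sup.1 hf
      rw [mul_add, Polynomial.C_mul]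
      refine dvd_add ?_ ?_
      · rw [mul_comm (Polynomial.C c₁), mul_assoc]
        exact (hN₁ f₁ hf₁).mul_left _
      · rw [mul_assoc]
        exact (hN₂ f₂ hf₂).mul_left _
  rintro y ⟨J, hJ, hJQ, hy⟩
  obtain ⟨J, rfl⟩ :=
    FractionalIdeal.le_one_iff_exists_coeIdeal.1 (hJQ.trans FractionalIdeal.coeIdeal_le_one)
  obtain ⟨c, hc, hcJ⟩ := hfg J (fg_of_coeIdeal_fg hJ)
    ((FractionalIdeal.coeIdeal_le_coeIdeal L).1 hJQ)
  have hinj := IsFractionRing.injective R[X] L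
  have hc0 : algebraMap R[X] L (Polynomial.C c) ≠ 0 :=
    (map_ne_zero_iff _ hinj).2 (Polynomial.C_ne_zero.2 hc)
  have ha0 : algebraMap R[X] L h / algebraMap R[X] L (Polynomial.C c) ≠ 0 :=
    div_ne_zero ((map_ne_zero_iff _ hinj).2 hh0) hc0
  -- The principal fractional ideal generated by `h / c` is divisorial, so it also contains `J_v`.
  -- An element `q` of `J_v` thus satisfies `c q ∈ hR[X] ⊆ Q`, while `c ∉ Q`.
  have hJle : (J : FractionalIdeal R[X]⁰ L) ≤ FractionalIdeal.spanSingleton R[X]⁰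
      (algebraMap R[X] L h / algebraMap R[X] L (Polynomial.C c)) * 1 := by
    intro z hz
    obtain ⟨f, hf, rfl⟩ := (FractionalIdeal.mem_coeIdeal _).1 hz
    obtain ⟨p, hp⟩ := hcJ f hf
    refine FractionalIdeal.mem_singleton_mul.2
      ⟨algebraMap R[X] L p, (FractionalIdeal.mem_one_iff _).2 ⟨p, rfl⟩, ?_⟩
    rw [div_mul_eq_mul_div, eq_div_iff hc0, ← _root_.map_mul, ← _root_.map_mul, ← hp, mul_comm]
  have hy' := (v R[X] L).mono _ _ hJle hy
  rw [(v R[X] L).map_smul _ _ ha0, (v R[X] L).map_one] at hy'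
  obtain ⟨_, hz, hyz⟩ := FractionalIdeal.mem_singleton_mul.1 hy'
  obtain ⟨p, rfl⟩ := (FractionalIdeal.mem_one_iff _).1 hz
  obtain ⟨q, rfl⟩ := (FractionalIdeal.mem_one_iff _).1 ((v R[X] L).apply_coeIdeal_le_one J hy)
  rw [div_mul_eq_mul_div, eq_div_iff hc0, ← _root_.map_mul, ← _root_.map_mul] at hyz
  refine (FractionalIdeal.mem_coeIdeal _).2 ⟨q, ?_, rfl⟩
  refine (hQ.mem_or_mem (hinj hyz ▸ Q.mul_mem_right p hhQ)).resolve_right fun hcQ => hc ?_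
  rwa [← Ideal.mem_comap, hQR, Ideal.mem_bot] at hcQ

/-! ### Contents and `t`-maximal ideals with nonzero contraction -/

/-- Shifting `g` past the degree of `f` before adding keeps the two lists of coefficients disjoint.
This makes the contents of members of `Q` a directed family. -/
theorem exists_contentIdeal_le_contentIdeal {Q : Ideal R[X]} {f g : R[X]} (hf : f ∈ Q) (hg : g ∈ Q) :
    ∃ h ∈ Q, f.contentIdeal ≤ h.contentIdeal ∧ g.contentIdeal ≤ h.contentIdeal := by
  have hcoeff : ∀ n, (f + g * Polynomial.X ^ (f.natDegree + 1)).coeff n =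
      if n ≤ f.natDegree then f.coeff n else g.coeff (n - (f.natDegree + 1)) := by
    intro n
    rw [Polynomial.coeff_add, Polynomial.coeff_mul_X_pow']
    split_ifs with h₁ h₂
    · omega
    · rw [Polynomial.coeff_eq_zero_of_natDegree_lt (by omega), zero_add]
    · rw [add_zero]
    · omega
  refine ⟨f + g * Polynomial.X ^ (f.natDegree + 1), Q.add_mem hf (Q.mul_mem_right _ hg), ?_, ?_⟩
  · refine Polynomial.contentIdeal_le_iff.2 fun n => ?_
    by_cases hn : n ≤ f.natDegree
    · rw [← (hcoeff n).trans (if_pos hn)]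
      exact Polynomial.coeff_mem_contentIdeal _ n
    · rw [Polynomial.coeff_eq_zero_of_natDegree_lt (by omega)]
      exact Ideal.zero_mem _
  · refine Polynomial.contentIdeal_le_iff.2 fun n => ?_
    have h := hcoeff (n + (f.natDegree + 1))
    rw [if_neg (by omega), Nat.add_sub_cancel] at h
    rw [← h]
    exact Polynomial.coeff_mem_contentIdeal _ _

/-- If the coefficients of `f` generate an ideal with trivial `v`-closure, so do `f` and any
nonzero constant. -/
theorem one_mem_v_span_C_pair {a : R} (ha : a ≠ 0) {f : R[X]}
    (hf : (1 : K) ∈ v R K (f.contentIdeal : FractionalIdeal R⁰ K)) :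
    (1 : L) ∈ v R[X] L
      ((Ideal.span {Polynomial.C a, f} : Ideal R[X]) : FractionalIdeal R[X]⁰ L) := by
  have hcont : (f.contentIdeal : FractionalIdeal R⁰ K) ≠ 0 := by
    intro h
    rw [h, (v R K).map_zero, FractionalIdeal.mem_zero_iff] at hf
    exact one_ne_zero hf
  have hone : ∀ x : K, x ∈ (1 : FractionalIdeal R⁰ K) ↔ x ∈ (algebraMap R K).range := fun x =>
    FractionalIdeal.mem_one_iff _
  have hmem : ∀ g ∈ Ideal.span {Polynomial.C a, f}, algebraMap R[X] L g ∈
      ((Ideal.span {Polynomial.C a, f} : Ideal R[X]) : FractionalIdeal R[X]⁰ L) := fun g hg =>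
    (FractionalIdeal.mem_coeIdeal _).2 ⟨g, hg, rfl⟩
  have hCa : Polynomial.C a ∈ Ideal.span {Polynomial.C a, f} := Ideal.subset_span (by simp)
  have hfm : f ∈ Ideal.span {Polynomial.C a, f} := Ideal.subset_span (by simp)
  have hspan : ((Ideal.span {Polynomial.C a, f} : Ideal R[X]) : FractionalIdeal R[X]⁰ L) ≠ 0 := by
    rw [FractionalIdeal.coeIdeal_ne_zero]
    intro h
    rw [h, Ideal.mem_bot, Polynomial.C_eq_zero] at hCa
    exact ha hCa
  refine (FractionalIdeal.mem_div_iff_of_ne_zero (one_div_ne_zero _ hspan)).2 fun z hz => ?_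
  rw [FractionalIdeal.mem_div_iff_of_ne_zero hspan] at hz
  have hza := hz _ (hmem _ hCa)
  have hzf := hz _ (hmem _ hfm)
  rw [algebraMap_C (K := K)] at hza
  -- `z a ∈ R[X]` makes `z` a polynomial `g` over `K`; then `g f ∈ R[X]` and McCoy's argument put
  -- `g` in `R[X]`.
  obtain ⟨g, rfl⟩ := exists_aeval_eq_of_mul_mem_one
    ((map_ne_zero_iff _ (IsFractionRing.injective R K)).2 ha) hza
  rw [one_mul, ← polyExt_one (K := K), aeval_mem_polyExt]
  rw [← aeval_map_eq (K := K) f, ← _root_.map_mul, ← polyExt_one (K := K),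
    aeval_mem_polyExt] at hzf
  refine fun n => (hone _).2 ((Polynomial.lifts_iff_coeff_lifts g).1
    (Polynomial.mem_lifts_of_map_mul_mem_lifts (algebraMap R K) f (fun x hx => ?_) g ?_) n)
  -- An `x` multiplied into `R` by all coefficients of `f` lies in the inverse of the content, whose
  -- `v`-closure contains `1`; so `x = 1 · x ∈ R`.
  · rw [← hone, ← one_mul x]
    refine (FractionalIdeal.mem_div_iff_of_ne_zero (one_div_ne_zero _ hcont)).1 hf x ?_
    rw [FractionalIdeal.mem_div_iff_of_ne_zero hcont]
    intro y hy
    obtain ⟨r, hr, rfl⟩ := (FractionalIdeal.mem_coeIdeal _).1 hy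
    have hle : f.contentIdeal ≤ (((1 : FractionalIdeal R⁰ K) : Submodule R K).comap
        (LinearMap.mulRight R x ∘ₗ Algebra.linearMap R K)) :=
      Polynomial.contentIdeal_le_iff.2 fun n => (hone _).2 (hx n)
    rw [mul_comm]
    exact hle hr
  · rw [mul_comm]
    exact (Polynomial.lifts_iff_coeff_lifts _).2 fun n => (hone _).1 (hzf n)

variable (K) in
/-- A `t`-maximal ideal of `R[X]` with nonzero contraction is extended from a `t`-maximal ideal
of `R`. -/
theorem exists_eq_map_C_of_mem_starMax_t {Q : Ideal R[X]} (hQ : Q ∈ (t R[X] L).starMax)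
    (hQR : Q.comap Polynomial.C ≠ ⊥) : ∃ M ∈ (t R K).starMax, Q = M.map Polynomial.C := by
  obtain ⟨a, haQ, ha⟩ := Submodule.exists_mem_ne_zero_of_ne_bot hQR
  have hle : ∀ f ∈ Q, f.contentIdeal ≤ sSup (Polynomial.contentIdeal '' (Q : Set R[X])) :=
    fun f hf => le_sSup ⟨f, hf, rfl⟩
  obtain ⟨M, hM, hAM⟩ := (isFiniteCharacter_t R K).exists_le_starMax
    (A := sSup (Polynomial.contentIdeal '' (Q : Set R[X]))) (by
      intro h
      have := hle _ haQ (Polynomial.coeff_mem_contentIdeal _ 0)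
      rw [h, Ideal.mem_bot, Polynomial.coeff_C_zero] at this
      exact ha this) (by
    rintro ⟨J, hJ, hJA, h1⟩
    obtain ⟨J, rfl⟩ :=
      FractionalIdeal.le_one_iff_exists_coeIdeal.1 (hJA.trans FractionalIdeal.coeIdeal_le_one)
    obtain ⟨_, ⟨f, hf, rfl⟩, hJf⟩ := exists_le_of_fg_le_sSup (fg_of_coeIdeal_fg hJ)
      (Set.Nonempty.image _ ⟨0, Q.zero_mem⟩) (by
        rintro _ ⟨f, hf, rfl⟩ _ ⟨g, hg, rfl⟩
        obtain ⟨h, hh, hfh, hgh⟩ := exists_contentIdeal_le_contentIdeal hf hg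
        exact ⟨_, ⟨h, hh, rfl⟩, hfh, hgh⟩) ((FractionalIdeal.coeIdeal_le_coeIdeal K).1 hJA)
    -- The finitely generated ideal `(a, f) ⊆ Q` would witness `1 ∈ Q_t`.
    refine hQ.1.one_notMem ⟨_, ?_, ?_, one_mem_v_span_C_pair ha
      ((v R K).mono _ _ ((FractionalIdeal.coeIdeal_le_coeIdeal K).2 hJf) h1)⟩
    · exact (FractionalIdeal.coeIdeal_fg _ (IsFractionRing.injective R[X] L) _).2
        (Submodule.fg_span (by simp))
    · rw [FractionalIdeal.coeIdeal_le_coeIdeal, Ideal.span_le]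
      rintro g (rfl | rfl)
      · exact haQ
      · exact hf)
  have hQM : Q ≤ M.map Polynomial.C := fun f hf =>
    Ideal.mem_map_C_iff.2 fun n => hAM (hle f hf (Polynomial.coeff_mem_contentIdeal f n))
  exact ⟨M, hM, le_antisymm hQM (hQ.2 (isStarPrime_t_map_C K hM.1) hQM)⟩

end Polynomial

end StarOperation

/-! ### The equivalences -/

theorem proposition2p8 {R K L : Type*} [CommRing R] [IsDomain R]
    [Field K] [Algebra R K] [IsFractionRing R K]
    [Field L] [Algebra R[X] L] [IsFractionRing R[X] L]
    [Algebra K L] [Algebra R L] [IsScalarTower R K L] [IsScalarTower R R[X] L]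
    (s : StarOperation R[X] L) (hs : s.IsFiniteCharacter) :
    List.TFAE [
      s.starMax = (StarOperation.t R[X] L).starMax,
      ∀ Q ∈ s.starMax, Q.comap Polynomial.C ≠ ⊥ →
        StarOperation.t R[X] L (Q : FractionalIdeal R[X]⁰ L) < 1,
      (s.induced K).starMax = (StarOperation.t R K).starMax ∧
        ∀ Q ∈ s.starMax, Q.comap Polynomial.C ≠ ⊥ →
          Q = (Q.comap Polynomial.C).map Polynomial.C] := by
  have hsK : (s.induced K).IsFiniteCharacter := hs.induced
  tfae_have 1 → 2 := by
    intro h Q hQ _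
    rw [h] at hQ
    refine lt_of_le_of_ne (StarOperation.apply_coeIdeal_le_one _ Q) fun h1 => hQ.1.one_notMem ?_
    rw [h1]
    exact FractionalIdeal.one_mem_one _
  tfae_have 2 → 1 := by
    refine fun h => hs.starMax_eq_t fun Q hQ => ?_
    by_cases hQR : Q.comap Polynomial.C = ⊥
    · exact StarOperation.isStarPrime_t_of_comap_C_eq_bot hQ.1.1 hQ.1.2.1 hQR
    · exact (hs.mem_starMax_t_of_lt_one hQ (h Q hQ hQR)).1
  tfae_have 1 → 3 := by
    intro h
    refine ⟨hsK.starMax_eq_t fun P hP => ?_, fun Q hQ hQR => ?_⟩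
    -- Since `P` is closed under the induced operation, `P[X]` has proper closure and lies in a
    -- `*`-maximal ideal. By (i) that ideal is `M[X]` with `M` `t`-maximal, so `P ⊆ M`, and
    -- maximality of `P` gives equality.
    · obtain ⟨Q, hQ, hPQ⟩ := hs.exists_le_starMax (StarOperation.map_C_ne_bot hP.1.2.1) (by
        intro h1
        refine hP.1.one_notMem ?_
        change algebraMap K L 1 ∈ s (StarOperation.polyExt L (P : FractionalIdeal R⁰ K))
        rwa [_root_.map_one, StarOperation.polyExt_coeIdeal])
      have hPQ' := Ideal.map_le_iff_le_comap.1 hPQ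
      rw [h] at hQ
      obtain ⟨M, hM, rfl⟩ := StarOperation.exists_eq_map_C_of_mem_starMax_t K hQ
        (ne_bot_of_le_ne_bot hP.1.2.1 hPQ')
      rw [StarOperation.comap_C_map_C] at hPQ'
      rw [le_antisymm hPQ' (hP.2 (hsK.isStarPrime_of_t hM.1) hPQ')]
      exact hM.1
    · rw [h] at hQ
      obtain ⟨M, -, rfl⟩ := StarOperation.exists_eq_map_C_of_mem_starMax_t K hQ hQR
      rw [StarOperation.comap_C_map_C]
  tfae_have 3 → 1 := by
    rintro ⟨hmax, hext⟩
    refine hs.starMax_eq_t fun Q hQ => ?_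
    by_cases hQR : Q.comap Polynomial.C = ⊥
    · exact StarOperation.isStarPrime_t_of_comap_C_eq_bot hQ.1.1 hQ.1.2.1 hQR
    -- The contraction of `Q` lies in a `t`-maximal ideal `M` of `R`, so `Q ⊆ M[X]`, which is a
    -- `t`-prime and hence `*`-prime; maximality of `Q` gives `Q = M[X]`.
    · have hQe := hext Q hQ hQR
      have hQp := hQ.1.1
      have hP : (s.induced K).IsStarPrime (Q.comap Polynomial.C) :=
        ⟨Ideal.comap_isPrime _ _, StarOperation.IsStarIdeal.induced_of_map_C K hQR (hQe ▸ hQ.1.2)⟩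
      obtain ⟨M, hM, hPM⟩ := hsK.exists_starPrime_le_starMax hP
      rw [hmax] at hM
      have hMX := StarOperation.isStarPrime_t_map_C (L := L) K hM.1
      have hQM : Q ≤ M.map Polynomial.C := hQe.trans_le (Ideal.map_mono hPM)
      rwa [le_antisymm hQM (hQ.2 (hs.isStarPrime_of_t hMX) hQM)]
  tfae_finish
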